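/- Let $R$ be an associative ring with identity; modules are unital left $R$-modules unless said otherwise. A module $F$ is flat if $-\otimes_R F$ sends injective maps of right $R$-modules to injective maps. A module $G$ is called strongly Gorenstein flat if there is an exact sequence $\cdots\to P_1\to P_0\to P^0\to P^1\to\cdots$ of projective modules which stays exact after applying $\mathrm{Hom}_R(-,F)$ for every flat module $F$, and such that $G\cong\mathrm{Ker}(P_0\to P^0)$. The strongly Gorenstein flat dimension $\mathrm{SGfd}(M)\in\{0,1,2,\dots\}\cup\{\infty\}$ of a module $M$ is the infimum of all $n\ge 0$ for which there is an exact sequence $0\to G_n\to\cdots\to G_1\to G_0\to M\to 0$ with every $G_i$ strongly Gorenstein flat, and it is $\infty$ if there is no such $n$. The left global strongly Gorenstein flat dimension of $R$ is $$l.\mathrm{SGfgldim}(R)=\sup\{\mathrm{SGfd}(M)\mid M\text{ is any left }R\text{-module}\}.$$ Then $$l.\mathrm{SGfgldim}(R)=\sup\{\mathrm{SGfd}(M)\mid M\text{ is a finitely generated left }R\text{-module}\}=\sup\{\mathrm{SGfd}(R/I)\mid I\text{ is a left ideal of }R\}.$$ -/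

import Mathlib

open scoped TensorProduct

universe u

noncomputable section

namespace SGFlat

section Tensor

variable (R : Type u) [Ring R]

/-- The subgroup of `N ⊗[ℤ] M` generated by the elements `(n * r) ⊗ m - n ⊗ (r * m)`, for a right
`R`-module `N` (a module over `Rᵐᵒᵖ`) and a left `R`-module `M`. -/
def balancedRelations (N M : Type u) [AddCommGroup N] [Module Rᵐᵒᵖ N]
    [AddCommGroup M] [Module R M] : AddSubgroup (N ⊗[ℤ] M) :=
  AddSubgroup.closure
    {t | ∃ (n : N) (r : R) (m : M), t = (MulOpposite.op r • n) ⊗ₜ[ℤ] m - n ⊗ₜ[ℤ] (r • m)}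

/-- The tensor product `N ⊗_R M` of a right module and a left module over a (not necessarily
commutative) ring `R`; it is an abelian group. -/
abbrev BalancedTensor (N M : Type u) [AddCommGroup N] [Module Rᵐᵒᵖ N]
    [AddCommGroup M] [Module R M] : Type u :=
  (N ⊗[ℤ] M) ⧸ balancedRelations R N M

variable {R}

theorem balancedRelations_le_comap {N N' : Type u} (M : Type u)
    [AddCommGroup N] [Module Rᵐᵒᵖ N] [AddCommGroup N'] [Module Rᵐᵒᵖ N']
    [AddCommGroup M] [Module R M] (f : N →ₗ[Rᵐᵒᵖ] N') :
    balancedRelations R N M ≤ (balancedRelations R N' M).comap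
      (LinearMap.rTensor M f.toAddMonoidHom.toIntLinearMap).toAddMonoidHom := by
  refine (AddSubgroup.closure_le _).2 ?_
  rintro _ ⟨n, r, m, rfl⟩
  refine AddSubgroup.subset_closure ⟨f n, r, m, ?_⟩
  simp

/-- The map `f ⊗_R M : N ⊗_R M → N' ⊗_R M` induced by a map `f : N → N'` of right `R`-modules. -/
def balancedMap {N N' : Type u} (M : Type u)
    [AddCommGroup N] [Module Rᵐᵒᵖ N] [AddCommGroup N'] [Module Rᵐᵒᵖ N']
    [AddCommGroup M] [Module R M] (f : N →ₗ[Rᵐᵒᵖ] N') :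
    BalancedTensor R N M →+ BalancedTensor R N' M :=
  QuotientAddGroup.map (balancedRelations R N M) (balancedRelations R N' M)
    (LinearMap.rTensor M f.toAddMonoidHom.toIntLinearMap).toAddMonoidHom
    (balancedRelations_le_comap M f)

end Tensor

variable (R : Type u) [Ring R]

/-- A left `R`-module `M` is flat if `- ⊗_R M` preserves injectivity of maps of right modules.
(Mathlib's `Module.Flat` is available over commutative rings only.) -/
def IsFlat (M : Type u) [AddCommGroup M] [Module R M] : Prop :=
  ∀ (N N' : Type u) [AddCommGroup N] [Module Rᵐᵒᵖ N] [AddCommGroup N'] [Module Rᵐᵒᵖ N']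
    (f : N →ₗ[Rᵐᵒᵖ] N'), Function.Injective f → Function.Injective (balancedMap M f)

/-- A left `R`-module `G` is strongly Gorenstein flat if there is an exact sequence
`⋯ → P (-1) → P 0 → P 1 → P 2 → ⋯` of projective left `R`-modules, indexed by `ℤ`, which stays
exact under `Hom_R(-, F)` for every flat left `R`-module `F`, and with
`G ≅ Ker (P 0 → P 1)`. -/
def IsStronglyGorensteinFlat (G : Type u) [AddCommGroup G] [Module R G] : Prop :=
  ∃ (P : ℤ → ModuleCat.{u} R) (d : ∀ i : ℤ, P i →ₗ[R] P (i + 1)),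
    (∀ i, Module.Projective R (P i)) ∧
    (∀ i, Function.Exact (d i) (d (i + 1))) ∧
    (∀ F : ModuleCat.{u} R, IsFlat R F → ∀ i,
      Function.Exact (fun g : P (i + 1 + 1) →ₗ[R] F => g ∘ₗ d (i + 1))
        (fun g : P (i + 1) →ₗ[R] F => g ∘ₗ d i)) ∧
    Nonempty (G ≃ₗ[R] LinearMap.ker (d 0))

/-- There is an exact sequence `0 → G n → ⋯ → G 1 → G 0 → M → 0` of left `R`-modules in which
`G 0, …, G n` are strongly Gorenstein flat (the sequence is continued by `G i = 0` for `i > n`). -/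
def HasSGFResolution (M : Type u) [AddCommGroup M] [Module R M] (n : ℕ) : Prop :=
  ∃ (G : ℕ → ModuleCat.{u} R) (d : ∀ i : ℕ, G (i + 1) →ₗ[R] G i) (ε : G 0 →ₗ[R] M),
    Function.Surjective ε ∧
    Function.Exact (d 0) ε ∧
    (∀ i, Function.Exact (d (i + 1)) (d i)) ∧
    (∀ i ≤ n, IsStronglyGorensteinFlat R (G i)) ∧
    (∀ i, n < i → Subsingleton (G i))

/-- The strongly Gorenstein flat dimension `SGfd(M)`: the least length of a resolution of `M` by
strongly Gorenstein flat modules, and `∞` if there is none. -/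
def sgfd (M : Type u) [AddCommGroup M] [Module R M] : ℕ∞ :=
  ⨅ (n : ℕ) (_ : HasSGFResolution R M n), (n : ℕ∞)

/-- The left global strongly Gorenstein flat dimension `l.SGfgldim(R)`. -/
def leftGlobalSGFDim : ℕ∞ :=
  ⨆ M : ModuleCat.{u} R, sgfd R M

end SGFlat

end

/-! Cyclic modules are finitely generated, so only one inequality has content: if every `R ⧸ I` has
dimension at most `n`, so does every module `M`. Well-order the elements of `M`; the submodules
generated by initial segments filter `M` with cyclic quotients. It then suffices to have an
Auslander-type lemma (`Filtration.hasSGFRes`): a module filtered by modules of dimension at most `n`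
has dimension at most `n`.

The case `n = 0` is closure under transfinite extensions. Strong Gorenstein flatness amounts to
belonging to a class closed under syzygies and cosyzygies and having no `Ext¹` into flat modules
(`isStronglyGorensteinFlat_of_class`). Modules filtered by strongly Gorenstein flat modules form
such a class: two transfinite horseshoe constructions, `Filtration.exists_syzygy` and
`Filtration.exists_cosyzygy`, give the first two closures, and Eklof's lemma gives the third.

The induction on `n` passes to syzygies with the same horseshoe. It needs every syzygy, not just a
chosen one, to lower the dimension bound (`HasSGFRes.syzygy`); this follows from closure under
extensions and under kernels of epimorphisms. -/

namespace SGFlat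

open Function

/-! ### Vanishing of `Ext¹` -/

section Basic

variable {R : Type u} [Ring R]

theorem exists_factor_of_surjective {L C Y : Type*} [AddCommGroup L] [Module R L]
    [AddCommGroup C] [Module R C] [AddCommGroup Y] [Module R Y]
    (σ : L →ₗ[R] C) (hσ : Surjective σ) (φ : L →ₗ[R] Y)
    (h : ∀ l, σ l = 0 → φ l = 0) : ∃ g : C →ₗ[R] Y, ∀ l, g (σ l) = φ l := by
  refine ⟨(Submodule.liftQ (LinearMap.ker σ) φ (fun l hl => h l hl)) ∘ₗ
    (σ.quotKerEquivOfSurjective hσ).symm.toLinearMap, fun l => ?_⟩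
  have : (σ.quotKerEquivOfSurjective hσ).symm (σ l) = Submodule.Quotient.mk l := by
    rw [LinearEquiv.symm_apply_eq]; rfl
  rw [LinearMap.comp_apply, LinearEquiv.coe_coe, this]
  rfl

theorem exists_lift_of_injective {T A P : Type*} [AddCommGroup T] [Module R T]
    [AddCommGroup A] [Module R A] [AddCommGroup P] [Module R P]
    (j : A →ₗ[R] P) (hj : Injective j) (φ : T →ₗ[R] P) (h : ∀ t, ∃ a, j a = φ t) :
    ∃ ψ : T →ₗ[R] A, ∀ t, j (ψ t) = φ t := by
  refine ⟨(LinearEquiv.ofInjective j hj).symm.toLinearMap ∘ₗ φ.codRestrict (LinearMap.range j) h,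
    fun t => ?_⟩
  exact congrArg Subtype.val ((LinearEquiv.ofInjective j hj).apply_symm_apply ⟨φ t, h t⟩)

/-- `0 → A → B → C → 0` is a short exact sequence. -/
structure ShortExact {A B C : Type*} [AddCommGroup A] [Module R A] [AddCommGroup B] [Module R B]
    [AddCommGroup C] [Module R C] (i : A →ₗ[R] B) (p : B →ₗ[R] C) : Prop where
  inj : Injective i
  exact : ∀ b, p b = 0 ↔ ∃ a, i a = b
  surj : Surjective p

variable (R) in
/-- `Ext¹(A, Y) = 0`, expressed by extending maps to `Y` along monomorphisms with cokernel `A`. -/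
def ExtVanish (A Y : Type u) [AddCommGroup A] [Module R A] [AddCommGroup Y] [Module R Y] : Prop :=
  ∀ (B C : ModuleCat.{u} R) (i : B →ₗ[R] C) (p : C →ₗ[R] A), ShortExact i p →
    ∀ f : B →ₗ[R] Y, ∃ g : C →ₗ[R] Y, ∀ b, g (i b) = f b

/-- `P` being projective, `q` lifts to `s : P → C`, which restricts to `t : A' → B`. Then `C` is a
quotient of `B × P`, and `f` glues with an extension of `f ∘ t` to `P`. -/
theorem ExtVanish.of_projective_presentation {A' P A Y : Type u} [AddCommGroup A'] [Module R A']
    [AddCommGroup P] [Module R P] [AddCommGroup A] [Module R A] [AddCommGroup Y] [Module R Y]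
    [Module.Projective R P] (j : A' →ₗ[R] P) (q : P →ₗ[R] A) (hs : ShortExact j q)
    (h : ∀ f : A' →ₗ[R] Y, ∃ g : P →ₗ[R] Y, ∀ a, g (j a) = f a) : ExtVanish R A Y := by
  intro B C i p hip f
  obtain ⟨s, hs'⟩ := Module.projective_lifting_property p q hip.surj
  have hs' : ∀ x, p (s x) = q x := fun x => LinearMap.congr_fun hs' x
  obtain ⟨t, ht⟩ := exists_lift_of_injective i hip.inj (s ∘ₗ j) fun a =>
    (hip.exact _).1 ((hs' _).trans ((hs.exact _).2 ⟨a, rfl⟩))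
  obtain ⟨e, he⟩ := h (f ∘ₗ t)
  obtain ⟨g, hg⟩ := exists_factor_of_surjective (i.coprod s) (fun c => by
      obtain ⟨x, hx⟩ := hs.surj (p c)
      obtain ⟨b, hb⟩ := (hip.exact (c - s x)).1 (by rw [map_sub, hs', hx, sub_self])
      exact ⟨(b, x), by simp [hb]⟩) (f.coprod e) (by
      rintro ⟨b, x⟩ hbx
      simp only [LinearMap.coprod_apply] at hbx ⊢
      have h0 : q x = 0 := by
        have hib : p (i b) = 0 := (hip.exact (i b)).2 ⟨b, rfl⟩
        have := congrArg p hbx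
        rwa [map_add, hib, zero_add, map_zero, hs'] at this
      obtain ⟨a, rfl⟩ := (hs.exact _).1 h0
      have hb : b + t a = 0 := hip.inj (by rw [map_add, ht, LinearMap.comp_apply, hbx, map_zero])
      rw [he, LinearMap.comp_apply, ← map_add, hb, map_zero])
  exact ⟨g, fun b => by simpa using hg (b, 0)⟩

theorem ExtVanish.of_projective (A Y : Type u) [AddCommGroup A] [Module R A] [AddCommGroup Y]
    [Module R Y] [Module.Projective R A] : ExtVanish R A Y :=
  .of_projective_presentation (0 : PUnit.{u+1} →ₗ[R] A) LinearMap.id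
    ⟨fun _ _ _ => rfl, fun b => ⟨fun h => ⟨0, h.symm⟩, fun ⟨_, h⟩ => h.symm⟩, surjective_id⟩
    (fun f => ⟨0, fun a => by rw [Subsingleton.elim a 0, map_zero, map_zero, map_zero]⟩)

/-- The extension of `A` is pulled back along `r` to an extension `D` of `A'`. The map extends to
`D`, and `c ↦ (c, s (p c))` brings it back to `C`. -/
theorem ExtVanish.of_retract {A A' Y : Type u} [AddCommGroup A] [Module R A] [AddCommGroup Y]
    [Module R Y] [AddCommGroup A'] [Module R A'] (s : A →ₗ[R] A') (r : A' →ₗ[R] A)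
    (h : ∀ a, r (s a) = a) (hA : ExtVanish R A' Y) : ExtVanish R A Y := by
  intro B C i p hip f
  let D : Submodule R (C × A') := LinearMap.eqLocus (p ∘ₗ LinearMap.fst R C A')
    (r ∘ₗ LinearMap.snd R C A')
  let i' : B →ₗ[R] D := (LinearMap.inl R C A' ∘ₗ i).codRestrict D (fun b => by
    simp [D, (hip.exact (i b)).2 ⟨b, rfl⟩])
  let s' : C →ₗ[R] D := (LinearMap.id.prod (s ∘ₗ p)).codRestrict D (fun c => by simp [D, h])
  obtain ⟨g, hg⟩ := hA (ModuleCat.of R B) (ModuleCat.of R D) i' (LinearMap.snd R C A' ∘ₗ D.subtype)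
    ⟨fun b b' hb => hip.inj (congrArg (fun d : D => d.1.1) hb), by
      rintro ⟨⟨c, a⟩, hd⟩
      simp only [D, LinearMap.mem_eqLocus, LinearMap.comp_apply, LinearMap.fst_apply,
        LinearMap.snd_apply] at hd
      constructor
      · intro ha
        obtain rfl : a = 0 := ha
        obtain ⟨b, rfl⟩ := (hip.exact c).1 (by rw [hd, map_zero])
        exact ⟨b, rfl⟩
      · rintro ⟨b, hb⟩
        exact congrArg (fun d : D => d.1.2) hb.symm, fun a => by
      obtain ⟨c, hc⟩ := hip.surj (r a)
      exact ⟨⟨(c, a), hc⟩, rfl⟩⟩ f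
  refine ⟨g ∘ₗ s', fun b => ?_⟩
  rw [← hg b]
  refine congrArg g (Subtype.ext (Prod.ext rfl ?_))
  change s (p (i b)) = 0
  rw [(hip.exact (i b)).2 ⟨b, rfl⟩, map_zero]

theorem ExtVanish.of_equiv {A A' Y : Type u} [AddCommGroup A] [Module R A] [AddCommGroup Y]
    [Module R Y] [AddCommGroup A'] [Module R A'] (e : A ≃ₗ[R] A') (hA : ExtVanish R A' Y) :
    ExtVanish R A Y :=
  hA.of_retract e.toLinearMap e.symm.toLinearMap e.symm_apply_apply

end Basic

/-! ### Projective modules are flat -/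

section Flat

variable {R : Type u} [Ring R]

/-- For a linear map `s : M → R^(ι)`, the induced map `N ⊗_R M → N^(ι)`. -/
noncomputable def balancedCoords (N : Type u) {M : Type u} {ι : Type u} [AddCommGroup N]
    [Module Rᵐᵒᵖ N]
    [AddCommGroup M] [Module R M] (s : M →ₗ[R] (ι →₀ R)) : BalancedTensor R N M →+ (ι →₀ N) :=
  QuotientAddGroup.lift _
    (TensorProduct.lift (AddMonoidHom.toIntLinearMap
      { toFun := fun n => AddMonoidHom.toIntLinearMap
          { toFun := fun m => (s m).mapRange (fun r => MulOpposite.op r • n) (by simp)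
            map_zero' := by ext; simp
            map_add' := fun a b => by ext; simp [add_smul] }
        map_zero' := by ext; simp
        map_add' := fun a b => by ext; simp })).toAddMonoidHom (by
    rw [← AddMonoidHom.comap_bot, balancedRelations, AddSubgroup.closure_le]
    rintro _ ⟨n, r, m, rfl⟩
    simp only [AddSubgroup.coe_comap, Set.mem_preimage, SetLike.mem_coe, AddSubgroup.mem_bot]
    ext i
    simp [mul_smul])

/-- The map `N^(ι) → N ⊗_R M` given by a family of elements of `M`. -/
noncomputable def balancedOfCoords (N : Type u) {M : Type u} {ι : Type u} [AddCommGroup N]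
    [Module Rᵐᵒᵖ N] [AddCommGroup M] [Module R M] (v : ι → M) :
    (ι →₀ N) →+ BalancedTensor R N M :=
  Finsupp.liftAddHom fun i => (QuotientAddGroup.mk' (balancedRelations R N M)).comp
    ((TensorProduct.mk ℤ N M).flip (v i)).toAddMonoidHom

theorem balanced_smul_tmul {N M : Type u} [AddCommGroup N]
    [Module Rᵐᵒᵖ N] [AddCommGroup M] [Module R M] (n : N) (r : R) (m : M) :
    (QuotientAddGroup.mk ((MulOpposite.op r • n) ⊗ₜ[ℤ] m) : BalancedTensor R N M) =
      QuotientAddGroup.mk (n ⊗ₜ[ℤ] (r • m)) := by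
  rw [← sub_eq_zero, ← QuotientAddGroup.mk_sub, QuotientAddGroup.eq_zero_iff]
  exact AddSubgroup.subset_closure ⟨n, r, m, rfl⟩

theorem balanced_induction {N M : Type u} [AddCommGroup N]
    [Module Rᵐᵒᵖ N] [AddCommGroup M] [Module R M] {Y : Type*} [AddCommGroup Y]
    {f g : BalancedTensor R N M →+ Y}
    (h : ∀ n m, f (QuotientAddGroup.mk (n ⊗ₜ[ℤ] m)) = g (QuotientAddGroup.mk (n ⊗ₜ[ℤ] m))) :
    f = g := by
  refine QuotientAddGroup.addMonoidHom_ext _ ?_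
  ext t
  induction t using TensorProduct.induction_on with
  | zero => simp
  | tmul n m => exact h n m
  | add a b ha hb => rw [map_add, map_add, ha, hb]

theorem balancedOfCoords_comp_balancedCoords (N : Type u) {M : Type u} {ι : Type u}
    [AddCommGroup N] [Module Rᵐᵒᵖ N] [AddCommGroup M] [Module R M] (s : M →ₗ[R] (ι →₀ R))
    (v : ι → M) (h : ∀ m, Finsupp.linearCombination R v (s m) = m) (t : BalancedTensor R N M) :
    balancedOfCoords N v (balancedCoords N s t) = t := by
  suffices H : (balancedOfCoords N v).comp (balancedCoords N s) = AddMonoidHom.id _ from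
    DFunLike.congr_fun H t
  refine balanced_induction (R := R) (N := N) (M := M) fun n m => ?_
  have h1 : balancedCoords N s (QuotientAddGroup.mk (n ⊗ₜ[ℤ] m)) =
    (s m).mapRange (fun r => MulOpposite.op r • n) (by simp) := rfl
  rw [AddMonoidHom.comp_apply, h1, balancedOfCoords, Finsupp.liftAddHom_apply,
    Finsupp.sum_mapRange_index (by simp)]
  conv_rhs => rw [← h m]
  rw [Finsupp.linearCombination_apply, Finsupp.sum, Finsupp.sum, TensorProduct.tmul_sum]
  have : ∀ i, ((QuotientAddGroup.mk' (balancedRelations R N M)).comp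
      ((TensorProduct.mk ℤ N M).flip (v i)).toAddMonoidHom) (MulOpposite.op (s m i) • n) =
      QuotientAddGroup.mk' (balancedRelations R N M) (n ⊗ₜ[ℤ] (s m i • v i)) := fun i =>
    balanced_smul_tmul n (s m i) (v i)
  rw [Finset.sum_congr rfl fun i _ => this i, ← map_sum]
  rfl

/-- A splitting of `R^(M) → M` embeds `N ⊗ M` in `N^(M)`, naturally in `N`, and there injectivity is
checked coordinatewise. This makes projectives admissible test modules for `Ext¹`, as the cosyzygy
construction requires. -/
theorem isFlat_of_projective (M : Type u) [AddCommGroup M] [Module R M] [Module.Projective R M] :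
    IsFlat R M := by
  obtain ⟨s, hs⟩ := Module.projective_def'.1 (inferInstance : Module.Projective R M)
  intro N N' _ _ _ _ f hf
  have hinj : Injective (balancedCoords N s) := fun a b hab => by
    have := congrArg (balancedOfCoords (R := R) (M := M) N id) hab
    rwa [balancedOfCoords_comp_balancedCoords N s id (LinearMap.congr_fun hs),
      balancedOfCoords_comp_balancedCoords N s id (LinearMap.congr_fun hs)] at this
  have hnat : (Finsupp.mapRange.addMonoidHom f.toAddMonoidHom).comp (balancedCoords N s) =
      (balancedCoords N' s).comp (balancedMap M f) := by
    refine balanced_induction (R := R) fun n m => ?_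
    ext i
    exact f.map_smul _ _
  have : Injective ((balancedCoords N' s).comp (balancedMap M f)) := by
    rw [← hnat]
    exact (Finsupp.mapRange_injective f (map_zero f) hf).comp hinj
  exact Injective.of_comp this

end Flat

/-! ### Complete resolutions cut into short exact sequences -/

section Sequence

variable {R : Type u} [Ring R]

/-- There is an exact sequence `0 → X → Q → Y → 0` with `Q` projective. -/
def IsSyzygy (X Y : ModuleCat.{u} R) : Prop :=
  ∃ (Q : ModuleCat.{u} R) (j : X →ₗ[R] Q) (q : Q →ₗ[R] Y), Module.Projective R Q ∧ ShortExact j q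

/-- The short exact sequences are spliced. A map killed by precomposition factors through the next
`K`, and extends to the following projective because the cokernel there is again a term of `K`. -/
theorem isStronglyGorensteinFlat_of_sequence (K : ℤ → ModuleCat.{u} R)
    (h : ∀ i, IsSyzygy (K i) (K (i + 1)))
    (hext : ∀ i (F : ModuleCat.{u} R), IsFlat R F → ExtVanish R (K i) F) :
    IsStronglyGorensteinFlat R (K 0) := by
  choose Q j q hQ hs using h
  refine ⟨Q, fun i => j (i + 1) ∘ₗ q i, hQ, fun i x => ?_, fun F hF i g => ?_, ⟨?_⟩⟩
  · rw [LinearMap.comp_apply, map_eq_zero_iff _ (hs _).inj, (hs (i + 1)).exact]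
    constructor
    · rintro ⟨y, rfl⟩
      obtain ⟨z, rfl⟩ := (hs i).surj y
      exact ⟨z, rfl⟩
    · rintro ⟨z, rfl⟩
      exact ⟨q i z, rfl⟩
  · constructor
    · intro hg
      obtain ⟨g1, hg1⟩ := exists_factor_of_surjective (q (i + 1)) (hs (i + 1)).surj g (fun l hl => by
        obtain ⟨y, rfl⟩ := ((hs (i + 1)).exact l).1 hl
        obtain ⟨z, rfl⟩ := (hs i).surj y
        exact LinearMap.congr_fun hg z)
      obtain ⟨g2, hg2⟩ := hext _ F hF _ _ _ _ (hs (i + 1 + 1)) g1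
      exact ⟨g2, LinearMap.ext fun x => (hg2 _).trans (hg1 x)⟩
    · rintro ⟨g', rfl⟩
      refine LinearMap.ext fun x => ?_
      have : q (i + 1) (j (i + 1) (q i x)) = 0 := ((hs (i + 1)).exact _).2 ⟨_, rfl⟩
      simp [this]
  · refine (LinearEquiv.ofInjective (j 0) (hs 0).inj).trans (LinearEquiv.ofEq _ _ ?_)
    ext x
    rw [LinearMap.mem_ker, LinearMap.comp_apply, map_eq_zero_iff _ (hs _).inj, (hs 0).exact]
    rfl

theorem isStronglyGorensteinFlat_of_sequence_apply (K : ℤ → ModuleCat.{u} R)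
    (h : ∀ i, IsSyzygy (K i) (K (i + 1)))
    (hext : ∀ i (F : ModuleCat.{u} R), IsFlat R F → ExtVanish R (K i) F) (n : ℤ) :
    IsStronglyGorensteinFlat R (K n) := by
  have := isStronglyGorensteinFlat_of_sequence (fun i => K (n + i))
    (fun i => by rw [← add_assoc]; exact h _) (fun i => hext _)
  rwa [add_zero] at this

theorem IsStronglyGorensteinFlat.exists_sequence {G : Type u} [AddCommGroup G] [Module R G]
    (h : IsStronglyGorensteinFlat R G) : ∃ K : ℤ → ModuleCat.{u} R, Nonempty (G ≃ₗ[R] K 0) ∧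
      (∀ i, IsSyzygy (K i) (K (i + 1))) ∧
      ∀ i (F : ModuleCat.{u} R), IsFlat R F → ExtVanish R (K i) F := by
  obtain ⟨P, d, hP, hd, hF, ⟨e⟩⟩ := h
  have hs : ∀ i, ShortExact (LinearMap.ker (d i)).subtype
      ((d i).codRestrict (LinearMap.ker (d (i + 1))) fun x => (hd i _).2 ⟨x, rfl⟩) := fun i =>
    ⟨Subtype.val_injective, fun b => ⟨fun hb => ⟨⟨b, congrArg Subtype.val hb⟩, rfl⟩, by
      rintro ⟨a, rfl⟩
      exact Subtype.ext a.2⟩, fun y => by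
      obtain ⟨x, hx⟩ := (hd i _).1 y.2
      exact ⟨x, Subtype.ext hx⟩⟩
  refine ⟨fun i => ModuleCat.of R (LinearMap.ker (d i)), ⟨e⟩, fun i =>
    ⟨P i, _, _, hP i, hs i⟩, fun i F hflat => ?_⟩
  -- The kernel at `k + 3` is presented by `P (k + 2)`. A map on the kernel at `k + 2`, pulled back
  -- to `P (k + 1)`, is killed by `d k`, so exactness of `Hom(-, F)` extends it to `P (k + 2)`.
  obtain ⟨k, rfl⟩ : ∃ k, i = k + 1 + 1 + 1 := ⟨i - 3, by ring⟩
  have := hP (k + 1 + 1)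
  refine .of_projective_presentation _ _ (hs (k + 1 + 1)) fun f => ?_
  obtain ⟨g, hg⟩ := (hF F hflat k (f ∘ₗ (d (k + 1)).codRestrict (LinearMap.ker (d (k + 1 + 1)))
    fun x => (hd (k + 1) _).2 ⟨x, rfl⟩)).1 (LinearMap.ext fun x => by
      have h0 : d (k + 1) (d k x) = 0 := (hd k _).2 ⟨x, rfl⟩
      have : (d (k + 1)).codRestrict (LinearMap.ker (d (k + 1 + 1)))
        (fun x => (hd (k + 1) _).2 ⟨x, rfl⟩) (d k x) = 0 := Subtype.ext h0
      simp only [LinearMap.comp_apply, this, map_zero, LinearMap.zero_apply])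
  refine ⟨g, fun a => ?_⟩
  obtain ⟨x, rfl⟩ := (hs (k + 1)).surj a
  exact LinearMap.congr_fun hg x

theorem IsStronglyGorensteinFlat.of_equiv {G G' : Type u} [AddCommGroup G] [Module R G]
    [AddCommGroup G'] [Module R G'] (e : G ≃ₗ[R] G') (h : IsStronglyGorensteinFlat R G) :
    IsStronglyGorensteinFlat R G' := by
  obtain ⟨P, d, hP, hd, hF, ⟨e'⟩⟩ := h
  exact ⟨P, d, hP, hd, hF, ⟨e.symm.trans e'⟩⟩

theorem IsStronglyGorensteinFlat.extVanish {G : Type u} [AddCommGroup G] [Module R G]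
    (h : IsStronglyGorensteinFlat R G) (F : ModuleCat.{u} R) (hF : IsFlat R F) :
    ExtVanish R G F := by
  obtain ⟨K, ⟨e⟩, -, hK⟩ := h.exists_sequence
  exact (hK 0 F hF).of_equiv e

theorem IsStronglyGorensteinFlat.exists_cosyzygy {G : Type u} [AddCommGroup G] [Module R G]
    (h : IsStronglyGorensteinFlat R G) : ∃ (G' : ModuleCat.{u} R),
      IsStronglyGorensteinFlat R G' ∧ IsSyzygy (ModuleCat.of R G) G' := by
  obtain ⟨K, ⟨e⟩, hs, hK⟩ := h.exists_sequence
  refine ⟨K 1, isStronglyGorensteinFlat_of_sequence_apply K hs hK 1, ?_⟩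
  · obtain ⟨Q, j, q, hQ, hjq⟩ := hs 0
    exact ⟨Q, j ∘ₗ e.toLinearMap, q, hQ, hjq.inj.comp e.injective, fun b => by
      rw [hjq.exact]
      exact e.surjective.exists.trans Iff.rfl, hjq.surj⟩

theorem IsStronglyGorensteinFlat.exists_syzygy {G : Type u} [AddCommGroup G] [Module R G]
    (h : IsStronglyGorensteinFlat R G) : ∃ (G' : ModuleCat.{u} R),
      IsStronglyGorensteinFlat R G' ∧ IsSyzygy G' (ModuleCat.of R G) := by
  obtain ⟨K, ⟨e⟩, hs, hK⟩ := h.exists_sequence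
  refine ⟨K (-1), isStronglyGorensteinFlat_of_sequence_apply K hs hK (-1), ?_⟩
  · obtain ⟨Q, j, q, hQ, hjq⟩ := hs (-1)
    exact ⟨Q, j, e.symm.toLinearMap ∘ₗ q, hQ, hjq.inj, fun b => by
      rw [← hjq.exact]
      exact map_eq_zero_iff e.symm.toLinearMap e.symm.injective, e.symm.surjective.comp hjq.surj⟩

/-- A class of modules closed under syzygies and cosyzygies whose members have no extensions
with flat modules consists of strongly Gorenstein flat modules. -/
theorem isStronglyGorensteinFlat_of_class (𝒢 : ModuleCat.{u} R → Prop)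
    (right : ∀ G, 𝒢 G → ∃ G', 𝒢 G' ∧ IsSyzygy G G')
    (left : ∀ G, 𝒢 G → ∃ G', 𝒢 G' ∧ IsSyzygy G' G)
    (hext : ∀ G, 𝒢 G → ∀ F : ModuleCat.{u} R, IsFlat R F → ExtVanish R G F)
    (G : ModuleCat.{u} R) (hG : 𝒢 G) : IsStronglyGorensteinFlat R G := by
  choose r hr hr' using fun X : {X // 𝒢 X} => right X.1 X.2
  choose l hl hl' using fun X : {X // 𝒢 X} => left X.1 X.2
  let rs : ℕ → {X // 𝒢 X} := fun n => Nat.rec ⟨G, hG⟩ (fun _ X => ⟨r X, hr X⟩) n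
  let ls : ℕ → {X // 𝒢 X} := fun n => Nat.rec ⟨l ⟨G, hG⟩, hl _⟩ (fun _ X => ⟨l X, hl X⟩) n
  -- Nonnegative indices carry iterated cosyzygies of `G`, and `negSucc n` carries its syzygy number
  -- `n + 1`.
  let K : ℤ → {X // 𝒢 X} := fun i => Int.rec rs ls i
  refine isStronglyGorensteinFlat_of_sequence (fun i => (K i).1) (fun i => ?_)
    (fun i => hext _ (K i).2)
  match i with
  | .ofNat n => exact hr' (rs n)
  | .negSucc 0 => exact hl' ⟨G, hG⟩
  | .negSucc (n + 1) => exact hl' (ls n)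

theorem isStronglyGorensteinFlat_of_projective (P : Type u) [AddCommGroup P] [Module R P]
    [Module.Projective R P] : IsStronglyGorensteinFlat R P := by
  have hz : Module.Projective R PUnit.{u + 1} := inferInstance
  refine isStronglyGorensteinFlat_of_class (fun X => Module.Projective R X)
    (fun G hG => ⟨ModuleCat.of R PUnit, hz, G, LinearMap.id, 0, hG, injective_id, fun b => ?_, ?_⟩)
    (fun G hG => ⟨ModuleCat.of R PUnit, hz, G, 0, LinearMap.id, hG, ?_, fun b => ?_,
      surjective_id⟩)
    (fun G hG F _ => .of_projective G F) (ModuleCat.of R P) ‹_›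
  · exact iff_of_true rfl ⟨b, rfl⟩
  · exact fun _ => ⟨0, rfl⟩
  · exact fun _ _ _ => rfl
  · exact ⟨fun h => ⟨0, h.symm⟩, fun ⟨_, h⟩ => h.symm⟩

end Sequence

end SGFlat
namespace SGFlat

open Function

/-! ### Well-ordered filtrations and Eklof's lemma -/

section Filtration

variable {R : Type u} [Ring R]

/-- A filtration of `K`, indexed by a linear order (a well-order in all uses), which starts at the
submodule `B` and has the modules `A x` as successive quotients: `F x` is the part of index at most
`x`, and `π x` identifies the quotient of `F x` by the part of smaller index with `A x`. -/
structure Filtration {K : Type u} [AddCommGroup K] [Module R K] (B : Submodule R K)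
    {ι : Type u} [LinearOrder ι] (A : ι → ModuleCat.{u} R) where
  F : ι → Submodule R K
  mono : Monotone F
  base_le : ∀ x, B ≤ F x
  exhaust : ∀ k, k ∈ B ∨ ∃ x, k ∈ F x
  π : ∀ x, F x →ₗ[R] A x
  surj : ∀ x, Surjective (π x)
  ker : ∀ x (k : F x), π x k = 0 ↔ (k : K) ∈ B ∨ ∃ y < x, (k : K) ∈ F y

namespace Filtration

variable {K : Type u} [AddCommGroup K] [Module R K] {B : Submodule R K}
  {ι : Type u} [LinearOrder ι] {A : ι → ModuleCat.{u} R}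

/-- The part of a filtration of index less than `x`. -/
def lt (Φ : Filtration B A) (x : ι) : Submodule R K := (LinearMap.ker (Φ.π x)).map (Φ.F x).subtype

theorem lt_le (Φ : Filtration B A) (x : ι) : Φ.lt x ≤ Φ.F x := Submodule.map_subtype_le _ _

theorem mem_lt_iff (Φ : Filtration B A) {x : ι} {k : K} (hk : k ∈ Φ.F x) :
    k ∈ Φ.lt x ↔ Φ.π x ⟨k, hk⟩ = 0 := by
  simp [lt, hk]

theorem mem_lt (Φ : Filtration B A) {x : ι} {k : K} :
    k ∈ Φ.lt x ↔ k ∈ B ∨ ∃ y < x, k ∈ Φ.F y := by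
  constructor
  · intro hk
    exact (Φ.ker x ⟨k, Φ.lt_le x hk⟩).1 ((Φ.mem_lt_iff _).1 hk)
  · intro hk
    have h : k ∈ Φ.F x := hk.elim (fun h => Φ.base_le x h) fun ⟨y, hy, h⟩ => Φ.mono hy.le h
    exact (Φ.mem_lt_iff h).2 ((Φ.ker x ⟨k, h⟩).2 hk)

theorem shortExact (Φ : Filtration B A) (x : ι) :
    ShortExact (Submodule.inclusion (Φ.lt_le x)) (Φ.π x) :=
  ⟨Submodule.inclusion_injective _, fun b => by
    rw [← Φ.mem_lt_iff b.2]
    exact ⟨fun h => ⟨⟨b, h⟩, rfl⟩, by rintro ⟨a, rfl⟩; exact a.2⟩, Φ.surj x⟩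

/-- At the least index whose part contains `k`, the element does not lie in the earlier part. -/
theorem exists_π_ne_zero [WellFoundedLT ι] (Φ : Filtration B A) {k : K} (hk : k ∉ B) :
    ∃ x, ∃ h : k ∈ Φ.F x, Φ.π x ⟨k, h⟩ ≠ 0 := by
  obtain ⟨x, hx, hmin⟩ := WellFounded.has_min (wellFounded_lt (α := ι)) {x | k ∈ Φ.F x}
    ((Φ.exhaust k).resolve_left hk)
  refine ⟨x, hx, fun h0 => ?_⟩
  obtain ⟨y, hy, hky⟩ := ((Φ.ker x _).1 h0).resolve_left hk
  exact hmin y hky hy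

/-- A filtration given by compatible surjections from modules `T x` onto its parts. -/
theorem exists_of_maps {T : ι → Type u} [∀ x, AddCommGroup (T x)] [∀ x, Module R (T x)]
    (i : ∀ x, T x →ₗ[R] K) (p : ∀ x, T x →ₗ[R] A x)
    (mono : ∀ x y, x ≤ y → LinearMap.range (i x) ≤ LinearMap.range (i y))
    (base_le : ∀ x, B ≤ LinearMap.range (i x)) (exhaust : ∀ k, k ∈ B ∨ ∃ x t, i x t = k)
    (surj : ∀ x, Surjective (p x))
    (ker : ∀ x t, p x t = 0 ↔ i x t ∈ B ∨ ∃ y < x, i x t ∈ LinearMap.range (i y)) :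
    Nonempty (Filtration B A) := by
  choose π hπ using fun x => exists_factor_of_surjective (i x).rangeRestrict
    (i x).surjective_rangeRestrict (p x) (fun t ht => (ker x t).2 (Or.inl (by
      have : i x t = 0 := congrArg Subtype.val ht
      rw [this]
      exact B.zero_mem)))
  refine ⟨⟨fun x => LinearMap.range (i x), fun x y => mono x y, base_le, exhaust, π,
    fun x a => ?_, fun x k => ?_⟩⟩
  · obtain ⟨t, rfl⟩ := surj x a
    exact ⟨_, hπ x t⟩
  · obtain ⟨t, rfl⟩ := (i x).surjective_rangeRestrict k
    rw [hπ]
    exact ker x t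

/-- The inverse image of a filtration under a surjection. -/
def comap (Φ : Filtration (⊥ : Submodule R K) A) {B' C : Type u} [AddCommGroup B'] [Module R B']
    [AddCommGroup C] [Module R C] (i : B' →ₗ[R] C) (p : C →ₗ[R] K) (h : ShortExact i p) :
    Filtration (LinearMap.range i) A where
  F x := (Φ.F x).comap p
  mono x y hxy := Submodule.comap_mono (Φ.mono hxy)
  base_le x := by
    rintro _ ⟨b, rfl⟩
    rw [Submodule.mem_comap, (h.exact _).2 ⟨b, rfl⟩]
    exact (Φ.F x).zero_mem
  exhaust k := (Φ.exhaust (p k)).imp_left fun hk => (h.exact k).1 hk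
  π x := Φ.π x ∘ₗ p.restrict (fun _ hc => hc)
  surj x a := by
    obtain ⟨⟨k, hk⟩, rfl⟩ := Φ.surj x a
    obtain ⟨c, rfl⟩ := h.surj k
    exact ⟨⟨c, hk⟩, rfl⟩
  ker x k := by
    rw [LinearMap.comp_apply, Φ.ker]
    exact or_congr (h.exact k) Iff.rfl

/-- Maps on `K` may be built along a filtration. -/
theorem exists_extension [WellFoundedLT ι] (Φ : Filtration B A) {T : Type u} [AddCommGroup T]
    [Module R T] (ρ : K → T → Prop) (base : ∃ f : B →ₗ[R] T, ∀ b : B, ρ b (f b))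
    (step : ∀ x (f : Φ.lt x →ₗ[R] T), (∀ k : Φ.lt x, ρ k (f k)) → ∃ g : Φ.F x →ₗ[R] T,
      (∀ k, g (Submodule.inclusion (Φ.lt_le x) k) = f k) ∧ ∀ k : Φ.F x, ρ k (g k)) :
    ∃ g : K →ₗ[R] T, ∀ k, ρ k (g k) := by
  -- Zorn's lemma is applied to partial maps whose domain is a union of `B` and parts of the
  -- filtration. This shape makes the domain of a maximal map equal `Φ.lt x` at the least index `x`
  -- it misses, so that `step` applies.
  let S : Set (K →ₗ.[R] T) := {f | B ≤ f.domain ∧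
    (∀ k ∈ f.domain, k ∈ B ∨ ∃ y, k ∈ Φ.F y ∧ Φ.F y ≤ f.domain) ∧ ∀ k : f.domain, ρ k (f k)}
  obtain ⟨f₀, hf₀⟩ := base
  obtain ⟨m, -, ⟨hm1, hm2, hm3⟩, hmax⟩ := zorn_le_nonempty₀ S (fun c hcS hc y hy => by
    have hd := hc.directedOn
    have hne : c.Nonempty := ⟨y, hy⟩
    refine ⟨LinearPMap.sSup c hd, ⟨?_, fun k hk => ?_, fun k => ?_⟩,
      fun z hz => LinearPMap.le_sSup hd hz⟩
    · exact (hcS hy).1.trans (LinearPMap.le_sSup hd hy).1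
    · obtain ⟨f, hf, hkf⟩ := (LinearPMap.mem_domain_sSup_iff hne hd).1 hk
      exact ((hcS hf).2.1 k hkf).imp_right fun ⟨y, hy, hyf⟩ =>
        ⟨y, hy, hyf.trans (LinearPMap.le_sSup hd hf).1⟩
    · obtain ⟨f, hf, hkf⟩ := (LinearPMap.mem_domain_sSup_iff hne hd).1 k.2
      have := LinearPMap.sSup_apply hd hf ⟨k, hkf⟩
      have h2 := (hcS hf).2.2 ⟨k, hkf⟩
      rw [← this] at h2
      exact h2) ⟨B, f₀⟩ ⟨le_rfl, fun k hk => Or.inl hk, hf₀⟩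
  by_cases hall : ∀ x, Φ.F x ≤ m.domain
  · have htop : ∀ k, k ∈ m.domain := fun k => (Φ.exhaust k).elim (fun h => hm1 h)
      fun ⟨x, hx⟩ => hall x hx
    exact ⟨m.toFun ∘ₗ LinearMap.id.codRestrict m.domain htop, fun k => hm3 ⟨k, htop k⟩⟩
  · exfalso
    obtain ⟨x, hx, hmin⟩ := WellFounded.has_min (wellFounded_lt (α := ι))
      {x | ¬ Φ.F x ≤ m.domain} (not_forall.1 hall)
    have hlt : ∀ y < x, Φ.F y ≤ m.domain := fun y hy => not_not.1 fun h => hmin y h hy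
    have h1 : Φ.lt x ≤ m.domain := fun k hk => (Φ.mem_lt.1 hk).elim (fun h => hm1 h)
      fun ⟨y, hy, h⟩ => hlt y hy h
    have h2 : m.domain ≤ Φ.lt x := fun k hk => Φ.mem_lt.2 ((hm2 k hk).imp_right
      fun ⟨y, hky, hy⟩ => ⟨y, not_le.1 fun hxy => hx ((Φ.mono hxy).trans hy), hky⟩)
    obtain ⟨g, hg, hgρ⟩ := step x (m.toFun ∘ₗ Submodule.inclusion h1)
      (fun k => hm3 (Submodule.inclusion h1 k))
    have hle : m ≤ ⟨Φ.F x, g⟩ := by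
      refine ⟨h2.trans (Φ.lt_le x), ?_⟩
      rintro ⟨a, ha⟩ ⟨b, hb⟩ (rfl : a = b)
      exact (hg ⟨a, h2 ha⟩).symm
    exact hx (hmax (show (⟨Φ.F x, g⟩ : K →ₗ.[R] T) ∈ S from
      ⟨Φ.base_le x, fun k hk => Or.inr ⟨x, hk, le_rfl⟩, hgρ⟩) hle).1

/-- Eklof's lemma. -/
theorem extVanish [WellFoundedLT ι] (Φ : Filtration (⊥ : Submodule R K) A) {Y : Type u}
    [AddCommGroup Y] [Module R Y] (h : ∀ x, ExtVanish R (A x) Y) : ExtVanish R K Y := by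
  intro B' C i p hip f
  -- The relation constrains values only on the range of `i`, the base of the pulled-back
  -- filtration; hence every extension beyond the base preserves it.
  obtain ⟨g, hg⟩ := (Φ.comap i p hip).exists_extension (fun c t => ∀ b, i b = c → t = f b) (by
      obtain ⟨ψ, hψ⟩ := exists_lift_of_injective i hip.inj (LinearMap.range i).subtype
        (fun t => t.2)
      exact ⟨f ∘ₗ ψ, fun c b hb => congrArg f (hip.inj (by rw [hψ, hb]; rfl))⟩) (by
      intro x f' hf'
      obtain ⟨g, hg⟩ := h x (ModuleCat.of R _) (ModuleCat.of R _) _ _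
        ((Φ.comap i p hip).shortExact x) f'
      refine ⟨g, hg, fun k b hb => ?_⟩
      have hk : (k : C) ∈ (Φ.comap i p hip).lt x := (Φ.comap i p hip).mem_lt.2 (Or.inl ⟨b, hb⟩)
      exact (hg ⟨k, hk⟩).trans (hf' ⟨k, hk⟩ b hb))
  exact ⟨g, fun b => hg _ b rfl⟩

end Filtration

end Filtration

/-! ### Transfinite horseshoe lemmas -/

section Horseshoe

variable {R : Type u} [Ring R] {ι : Type u} [LinearOrder ι]

/-- The finitely supported families which vanish at all indices greater than `x`. -/
def supportedLE (P : ι → ModuleCat.{u} R) (x : ι) : Submodule R (Π₀ x, P x) where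
  carrier := {v | ∀ y, x < y → v y = 0}
  zero_mem' _ _ := rfl
  add_mem' ha hb y hy := by rw [DFinsupp.add_apply, ha y hy, hb y hy, add_zero]
  smul_mem' r a ha y hy := by rw [DFinsupp.smul_apply, ha y hy, smul_zero]

theorem supportedLE_mono (P : ι → ModuleCat.{u} R) : Monotone (supportedLE P) :=
  fun _ _ hxy _ hv z hz => hv z (hxy.trans_lt hz)

theorem single_mem_supportedLE (P : ι → ModuleCat.{u} R) (x : ι) (a : P x) :
    DFinsupp.single x a ∈ supportedLE P x :=
  fun _ hy => DFinsupp.single_eq_of_ne hy.ne'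

theorem exists_mem_supportedLE (P : ι → ModuleCat.{u} R) (v : Π₀ x, P x) :
    v = 0 ∨ ∃ x, v ∈ supportedLE P x ∧ v x ≠ 0 := by
  classical
  refine or_iff_not_imp_left.2 fun hv => ?_
  have hne : v.support.Nonempty := Finset.nonempty_iff_ne_empty.2 fun h =>
    hv (DFinsupp.support_eq_empty.1 h)
  refine ⟨v.support.max' hne, fun y hy => ?_, DFinsupp.mem_support_iff.1 (Finset.max'_mem _ hne)⟩
  by_contra hvy
  exact (Finset.le_max' _ y (DFinsupp.mem_support_iff.2 hvy)).not_gt hy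

theorem exists_lt_mem_supportedLE {P : ι → ModuleCat.{u} R} {x : ι} {v : Π₀ x, P x}
    (hv : v ∈ supportedLE P x) (hx : v x = 0) : v = 0 ∨ ∃ y < x, v ∈ supportedLE P y := by
  refine (exists_mem_supportedLE P v).imp_right fun ⟨y, hy, hne⟩ => ⟨y, ?_, hy⟩
  refine lt_of_le_of_ne (not_lt.1 fun h => hne (hv y h)) ?_
  rintro rfl
  exact hne hx

variable [WellFoundedLT ι]

/-- Each `p x` lifts through `Φ.F x`, and the lifts add up to `σ` from the direct sum of the `P x`
to `K`. Filtering the sum by largest index in the support makes `σ` filtered with graded pieces `p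
x`, so its kernel is filtered by the `A' x`. -/
theorem Filtration.exists_syzygy {K : ModuleCat.{u} R} {A A' : ι → ModuleCat.{u} R}
    (Φ : Filtration (⊥ : Submodule R K) A) (h : ∀ x, IsSyzygy (A' x) (A x)) :
    ∃ K' : ModuleCat.{u} R, IsSyzygy K' K ∧ Nonempty (Filtration (⊥ : Submodule R K') A') := by
  classical
  choose P j p hP hs using h
  choose q hq using fun x => Module.projective_lifting_property (Φ.π x) (p x) (Φ.surj x)
  have hq : ∀ x v, Φ.π x (q x v) = p x v := fun x v => LinearMap.congr_fun (hq x) v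
  let σ : (Π₀ x, P x) →ₗ[R] K := DFinsupp.lsum ℕ fun x => (Φ.F x).subtype ∘ₗ q x
  have hσ : ∀ x v, σ (DFinsupp.single x v) = q x v := fun x v => by simp [σ]
  have hσmem : ∀ (N : Submodule R K) (v : Π₀ x, P x), (∀ x, v x ≠ 0 → Φ.F x ≤ N) → σ v ∈ N := by
    intro N v hv
    have : σ v = v.sum fun x a => (q x a : K) := by
      simp only [σ, DFinsupp.lsum_apply_apply, DFinsupp.sumAddHom_apply]
      rfl
    rw [this]
    exact Submodule.sum_mem _ fun x hx => hv x (DFinsupp.mem_support_iff.1 hx) (q x _).2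
  have hσF : ∀ x, ∀ v ∈ supportedLE P x, σ v ∈ Φ.F x := fun x v hv => hσmem _ v fun y hy =>
    Φ.mono (not_lt.1 fun hxy => hy (hv y hxy))
  -- Only the coordinate at `x` survives in the quotient `A x`; all lower ones land in `Φ.lt x`.
  have hπσ : ∀ x, ∀ v (hv : v ∈ supportedLE P x), Φ.π x ⟨σ v, hσF x v hv⟩ = p x (v x) := by
    intro x v hv
    have h1 : σ (v - DFinsupp.single x (v x)) ∈ Φ.lt x := by
      refine hσmem _ _ fun y hy k hk => Φ.mem_lt.2 (Or.inr ⟨y, ?_, hk⟩)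
      by_contra hxy
      rcases eq_or_lt_of_le (not_lt.1 hxy) with rfl | hlt
      · simp at hy
      · rw [DFinsupp.sub_apply, hv y hlt, DFinsupp.single_eq_of_ne hlt.ne', sub_zero] at hy
        exact hy rfl
    have h2 := (Φ.mem_lt_iff (Φ.lt_le x h1)).1 h1
    have h3 : (⟨σ (v - DFinsupp.single x (v x)), Φ.lt_le x h1⟩ : Φ.F x) =
        ⟨σ v, hσF x v hv⟩ - q x (v x) := Subtype.ext (by simp [hσ])
    rw [h3, map_sub, hq, sub_eq_zero] at h2
    exact h2
  have hsurj : ∀ x, ∀ k ∈ Φ.F x, ∃ v ∈ supportedLE P x, σ v = k := by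
    intro x
    induction x using WellFoundedLT.induction with
    | ind x ih =>
      intro k hk
      obtain ⟨a, ha⟩ := (hs x).surj (Φ.π x ⟨k, hk⟩)
      have hlt : k - q x a ∈ Φ.lt x := by
        refine (Φ.mem_lt_iff ((Φ.F x).sub_mem hk (q x a).2)).2 ?_
        rw [← sub_eq_zero.2 ha.symm, ← hq, ← map_sub]
        rfl
      have : ∃ v ∈ supportedLE P x, σ v = k - q x a := by
        rcases Φ.mem_lt.1 hlt with h0 | ⟨y, hy, hky⟩
        · exact ⟨0, Submodule.zero_mem _, by rw [map_zero]; exact h0.symm⟩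
        · obtain ⟨v, hv, hvk⟩ := ih y hy _ hky
          exact ⟨v, supportedLE_mono P hy.le hv, hvk⟩
      obtain ⟨v, hv, hvk⟩ := this
      exact ⟨v + DFinsupp.single x a, Submodule.add_mem _ hv (single_mem_supportedLE P x a),
        by rw [map_add, hvk, hσ, sub_add_cancel]⟩
  refine ⟨ModuleCat.of R (LinearMap.ker σ), ⟨ModuleCat.of R (Π₀ x, P x), (LinearMap.ker σ).subtype,
    σ, inferInstanceAs (Module.Projective R (Π₀ x, P x)), Subtype.val_injective,
    fun b => ⟨fun hb => ⟨⟨b, hb⟩, rfl⟩, by rintro ⟨a, rfl⟩; exact a.2⟩, fun k => ?_⟩, ?_⟩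
  · rcases Φ.exhaust k with h0 | ⟨x, hx⟩
    · exact ⟨0, by rw [map_zero]; exact h0.symm⟩
    · obtain ⟨v, -, hv⟩ := hsurj x k hx
      exact ⟨v, hv⟩
  · have hlift : ∀ x (t : (supportedLE P x).comap (LinearMap.ker σ).subtype),
        ∃ a, j x a = t.1.1 x := fun x t => by
      refine ((hs x).exact _).1 ((hπσ x t.1.1 t.2).symm.trans ?_)
      rw [← map_zero (Φ.π x)]
      exact congrArg _ (Subtype.ext t.1.2)
    choose π hπ using fun x => exists_lift_of_injective
      (T := (supportedLE P x).comap (LinearMap.ker σ).subtype) (j x) (hs x).inj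
      (DFinsupp.lapply (R := R) x ∘ₗ (LinearMap.ker σ).subtype ∘ₗ
        ((supportedLE P x).comap (LinearMap.ker σ).subtype).subtype) (hlift x)
    refine ⟨⟨fun x => (supportedLE P x).comap (LinearMap.ker σ).subtype,
      fun x y hxy => Submodule.comap_mono (supportedLE_mono P hxy), fun x => bot_le,
      fun k => ?_, π, fun x a => ?_, fun x k => ?_⟩⟩
    · rcases exists_mem_supportedLE P k.1 with h0 | ⟨x, hx, -⟩
      · exact Or.inl (Subtype.ext h0)
      · exact Or.inr ⟨x, hx⟩
    -- The vector `single x (j x a)` need not lie in `ker σ`, but its image is also the image of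
    -- some `v` with vanishing coordinate at `x`; subtracting `v` corrects it.
    · have hlt : (q x (j x a) : K) ∈ Φ.lt x := by
        rw [Φ.mem_lt_iff (q x (j x a)).2]
        exact (hq x _).trans (((hs x).exact _).2 ⟨a, rfl⟩)
      have : ∃ v ∈ supportedLE P x, v x = 0 ∧ σ v = q x (j x a) := by
        rcases Φ.mem_lt.1 hlt with h0 | ⟨y, hy, hky⟩
        · exact ⟨0, Submodule.zero_mem _, rfl, by rw [map_zero]; exact h0.symm⟩
        · obtain ⟨v, hv, hvk⟩ := hsurj y _ hky
          exact ⟨v, supportedLE_mono P hy.le hv, hv x hy, hvk⟩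
      obtain ⟨v, hv, hvx, hvk⟩ := this
      have hker : DFinsupp.single x (j x a) - v ∈ LinearMap.ker σ := by
        rw [LinearMap.mem_ker, map_sub, hσ, hvk, sub_self]
      have hle : DFinsupp.single x (j x a) - v ∈ supportedLE P x :=
        Submodule.sub_mem _ (single_mem_supportedLE P x _) hv
      refine ⟨⟨⟨_, hker⟩, hle⟩, (hs x).inj ?_⟩
      rw [hπ]
      simp [hvx]
    · rw [← map_eq_zero_iff _ (hs x).inj, hπ]
      constructor
      · intro h0
        rcases exists_lt_mem_supportedLE k.2 h0 with h0 | h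
        · exact Or.inl (Subtype.ext h0)
        · exact Or.inr h
      · rintro (h0 | ⟨y, hy, hky⟩)
        · have : k.1 = 0 := h0
          simp [this]
        · exact hky x hy

/-- Transfinite recursion builds `Ψ` from `K` to the direct sum of the `Q x`, such that on `Φ.F y`
all coordinates above `y` vanish and the one at `y` is `j y ∘ Φ.π y`. Extending past `A x` is
possible because the direct sum is projective. The leading coordinates make `Ψ` injective with
cokernel filtered by the `A' x`. -/
theorem Filtration.exists_cosyzygy {K : ModuleCat.{u} R} {A A' : ι → ModuleCat.{u} R}
    (Φ : Filtration (⊥ : Submodule R K) A) (h : ∀ x, IsSyzygy (A x) (A' x))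
    (hext : ∀ x (Q : ModuleCat.{u} R), Module.Projective R Q → ExtVanish R (A x) Q) :
    ∃ K' : ModuleCat.{u} R, IsSyzygy K K' ∧ Nonempty (Filtration (⊥ : Submodule R K') A') := by
  classical
  choose Q j c hQ hs using h
  have hproj : Module.Projective R (Π₀ x, Q x) := inferInstance
  obtain ⟨Ψ, hΨ⟩ := Φ.exists_extension (T := Π₀ x, Q x) (fun k t => ∀ y (hk : k ∈ Φ.F y),
      t ∈ supportedLE Q y ∧ t y = j y (Φ.π y ⟨k, hk⟩))
    ⟨0, fun b y hb => by
      have : (⟨b, hb⟩ : Φ.F y) = 0 := Subtype.ext b.2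
      rw [this, map_zero, map_zero]
      exact ⟨Submodule.zero_mem _, rfl⟩⟩
    (by
      intro x f hf
      obtain ⟨g, hg⟩ := hext x (ModuleCat.of R (Π₀ x, Q x)) hproj (ModuleCat.of R _)
        (ModuleCat.of R _) _ _ (Φ.shortExact x) f
      -- The extension `g` has no control on supports: its coordinates from `x` on are discarded and
      -- the prescribed one at `x` is added. On `Φ.lt x` nothing changes, since `f` is already
      -- supported below `x`.
      let g' : Φ.F x →ₗ[R] (Π₀ x, Q x) := DFinsupp.filterLinearMap R (fun y => Q y) (· < x) ∘ₗ g +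
        DFinsupp.lsingle x ∘ₗ j x ∘ₗ Φ.π x
      have hg' : ∀ k z, g' k z = (if z < x then g k z else 0) +
          (DFinsupp.single x (j x (Φ.π x k)) : Π₀ x, Q x) z := by
        intro k z
        simp [g', DFinsupp.filter_apply]
      have hgf : ∀ k, g' (Submodule.inclusion (Φ.lt_le x) k) = f k := by
        intro k
        ext z
        have h0 : Φ.π x (Submodule.inclusion (Φ.lt_le x) k) = 0 := (Φ.mem_lt_iff _).1 k.2
        rw [hg', h0, map_zero, DFinsupp.single_zero, DFinsupp.zero_apply, add_zero]
        split_ifs with hz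
        · exact congrArg (fun t : Π₀ x, Q x => t z) (hg k)
        · rcases Φ.mem_lt.1 k.2 with h0 | ⟨y, hy, hky⟩
          · have : k = 0 := Subtype.ext h0
            simp [this]
          · exact ((hf k y hky).1 z (hy.trans_le (not_lt.1 hz))).symm
      refine ⟨g', hgf, fun k y hk => ?_⟩
      by_cases hlt : (k : K) ∈ Φ.lt x
      · rw [show g' k = f ⟨k, hlt⟩ from hgf ⟨k, hlt⟩]
        exact hf ⟨k, hlt⟩ y hk
      · have hxy : x ≤ y := not_lt.1 fun hyx => hlt (Φ.mem_lt.2 (Or.inr ⟨y, hyx, hk⟩))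
        refine ⟨fun z hz => ?_, ?_⟩
        · have hxz := hxy.trans_lt hz
          rw [hg', if_neg hxz.not_gt, DFinsupp.single_eq_of_ne hxz.ne', add_zero]
        · rcases eq_or_lt_of_le hxy with rfl | hxy
          · rw [hg', if_neg (lt_irrefl _), DFinsupp.single_eq_same, zero_add]
          · rw [hg', if_neg hxy.not_gt, DFinsupp.single_eq_of_ne hxy.ne', zero_add,
              (Φ.ker y ⟨k, hk⟩).2 (Or.inr ⟨x, hxy, k.2⟩), map_zero])
  -- Strictness of `Ψ`: a nonzero `Ψ`-coordinate of `k` occurs at some `z` with `k ∈ Φ.F z`, and the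
  -- support bound forces `z ≤ x`.
  have hmem : ∀ x k, Ψ k ∈ supportedLE Q x → k ∈ Φ.F x := by
    intro x k hk
    by_cases h0 : k ∈ (⊥ : Submodule R K)
    · exact Φ.base_le x h0
    · obtain ⟨z, hz, hne⟩ := Φ.exists_π_ne_zero h0
      have h1 : Ψ k z ≠ 0 := by
        rw [(hΨ k z hz).2]
        exact fun h => hne ((map_eq_zero_iff _ (hs z).inj).1 h)
      exact Φ.mono (not_lt.1 fun hxz => h1 (hk z hxz)) hz
  refine ⟨ModuleCat.of R ((Π₀ x, Q x) ⧸ LinearMap.range Ψ), ⟨ModuleCat.of R (Π₀ x, Q x), Ψ,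
    (LinearMap.range Ψ).mkQ, hproj, ?_, fun b => (Submodule.Quotient.mk_eq_zero _).trans Iff.rfl,
    Submodule.mkQ_surjective _⟩, ?_⟩
  · refine (injective_iff_map_eq_zero Ψ).2 fun k hk => ?_
    by_contra h0
    obtain ⟨z, hz, hne⟩ := Φ.exists_π_ne_zero (k := k) h0
    refine hne ((map_eq_zero_iff _ (hs z).inj).1 ?_)
    rw [← (hΨ k z hz).2, hk]
    rfl
  · refine Filtration.exists_of_maps (T := fun x => supportedLE Q x)
      (fun x => (LinearMap.range Ψ).mkQ ∘ₗ (supportedLE Q x).subtype)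
      (fun x => c x ∘ₗ DFinsupp.lapply (R := R) x ∘ₗ (supportedLE Q x).subtype) ?_
      (fun x => bot_le) ?_ ?_ ?_
    · rintro x y hxy _ ⟨t, rfl⟩
      exact ⟨⟨t, supportedLE_mono Q hxy t.2⟩, rfl⟩
    · intro k
      obtain ⟨v, rfl⟩ := Submodule.mkQ_surjective _ k
      rcases exists_mem_supportedLE Q v with rfl | ⟨x, hx, -⟩
      · exact Or.inl (map_zero _)
      · exact Or.inr ⟨x, ⟨v, hx⟩, rfl⟩
    · intro x a
      obtain ⟨b, rfl⟩ := (hs x).surj a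
      exact ⟨⟨_, single_mem_supportedLE Q x b⟩, by simp⟩
    · rintro x ⟨v, hv⟩
      constructor
      · intro h0
        obtain ⟨a, ha⟩ := ((hs x).exact (v x)).1 h0
        obtain ⟨⟨k, hk⟩, rfl⟩ := Φ.surj x a
        have hw : v - Ψ k ∈ supportedLE Q x := Submodule.sub_mem _ hv (hΨ k x hk).1
        have heq : (LinearMap.range Ψ).mkQ v = (LinearMap.range Ψ).mkQ (v - Ψ k) := by
          have : (LinearMap.range Ψ).mkQ (Ψ k) = 0 :=
            (Submodule.Quotient.mk_eq_zero (LinearMap.range Ψ)).2 ⟨k, rfl⟩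
          rw [map_sub, this, sub_zero]
        rcases exists_lt_mem_supportedLE hw (by
          rw [DFinsupp.sub_apply, (hΨ k x hk).2, ha, sub_self]) with h | ⟨y, hy, h⟩
        · exact Or.inl (heq.trans (by rw [h, map_zero]))
        · exact Or.inr ⟨y, hy, ⟨_, h⟩, heq.symm⟩
      · intro h
        obtain ⟨w, hw, hwx, heq⟩ : ∃ w ∈ supportedLE Q x, w x = 0 ∧
            (LinearMap.range Ψ).mkQ v = (LinearMap.range Ψ).mkQ w := by
          rcases h with h | ⟨y, hy, ⟨w, hw⟩, h⟩
          · exact ⟨0, Submodule.zero_mem _, rfl, Eq.trans h (map_zero _).symm⟩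
          · exact ⟨w, supportedLE_mono Q hy.le hw, hw x hy, h.symm⟩
        obtain ⟨k, hk⟩ := (Submodule.Quotient.eq _).1 heq
        have hkx : k ∈ Φ.F x := hmem x k (by rw [hk]; exact Submodule.sub_mem _ hv hw)
        have h1 := (hΨ k x hkx).2
        rw [hk, DFinsupp.sub_apply, hwx, sub_zero] at h1
        exact ((hs x).exact _).2 ⟨_, h1.symm⟩

/-- Strongly Gorenstein flat modules are closed under transfinite extensions. -/
theorem Filtration.isStronglyGorensteinFlat {K : ModuleCat.{u} R} {A : ι → ModuleCat.{u} R}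
    (Φ : Filtration (⊥ : Submodule R K) A) (h : ∀ x, IsStronglyGorensteinFlat R (A x)) :
    IsStronglyGorensteinFlat R K := by
  refine isStronglyGorensteinFlat_of_class (fun X => ∃ A : ι → ModuleCat.{u} R,
    (∀ x, IsStronglyGorensteinFlat R (A x)) ∧ Nonempty (Filtration (⊥ : Submodule R X) A))
    ?_ ?_ ?_ K ⟨A, h, ⟨Φ⟩⟩
  · rintro X ⟨A, hA, ⟨Φ⟩⟩
    choose A' hA' hs using fun x => (hA x).exists_cosyzygy
    obtain ⟨X', h1, h2⟩ := Φ.exists_cosyzygy hs fun x Q hQ =>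
      (hA x).extVanish Q (isFlat_of_projective Q)
    exact ⟨X', ⟨A', hA', h2⟩, h1⟩
  · rintro X ⟨A, hA, ⟨Φ⟩⟩
    choose A' hA' hs using fun x => (hA x).exists_syzygy
    obtain ⟨X', h1, h2⟩ := Φ.exists_syzygy hs
    exact ⟨X', ⟨A', hA', h2⟩, h1⟩
  · rintro X ⟨A, hA, ⟨Φ⟩⟩ F hF
    exact Φ.extVanish fun x => (hA x).extVanish F hF

end Horseshoe

end SGFlat
namespace SGFlat

open Function

/-! ### Extensions and kernels of epimorphisms -/

section Closure

variable {R : Type u} [Ring R]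

/-- An extension is a two-step filtration, indexed by `Bool`. -/
theorem ShortExact.isStronglyGorensteinFlat {A B C : ModuleCat.{u} R} {i : A →ₗ[R] B}
    {p : B →ₗ[R] C} (h : ShortExact i p) (hA : IsStronglyGorensteinFlat R A)
    (hC : IsStronglyGorensteinFlat R C) : IsStronglyGorensteinFlat R B := by
  let X : ULift.{u} Bool → ModuleCat.{u} R := fun b => bif b.down then C else A
  let T : ULift.{u} Bool → ModuleCat.{u} R := fun b => bif b.down then B else A
  let t : ∀ b, T b →ₗ[R] B
    | ⟨true⟩ => LinearMap.id
    | ⟨false⟩ => i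
  let q : ∀ b, T b →ₗ[R] X b
    | ⟨true⟩ => p
    | ⟨false⟩ => LinearMap.id
  have hlt : (⟨false⟩ : ULift.{u} Bool) < ⟨true⟩ := by decide
  obtain ⟨Φ⟩ : Nonempty (Filtration (⊥ : Submodule R B) X) := by
    refine Filtration.exists_of_maps t q ?_ (fun _ => bot_le) (fun k => Or.inr ⟨⟨true⟩, k, rfl⟩)
      ?_ ?_
    · rintro ⟨_ | _⟩ ⟨_ | _⟩ hxy
      · exact le_rfl
      · rintro k -
        exact ⟨k, rfl⟩
      · exact absurd hlt hxy.not_gt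
      · exact le_rfl
    · rintro ⟨_ | _⟩
      · exact surjective_id
      · exact h.surj
    · rintro ⟨_ | _⟩ k
      · refine (map_eq_zero_iff i h.inj).symm.trans ⟨Or.inl, ?_⟩
        rintro (h0 | ⟨⟨_ | _⟩, hy, -⟩)
        · exact h0
        · exact absurd hy (lt_irrefl _)
        · exact absurd hy hlt.not_gt
      · refine (h.exact k).trans ⟨fun ha => Or.inr ⟨_, hlt, ha⟩, ?_⟩
        rintro (h0 | ⟨⟨_ | _⟩, hy, ha⟩)
        · exact ⟨0, (map_zero i).trans h0.symm⟩
        · exact ha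
        · exact absurd hy (lt_irrefl _)
  refine Φ.isStronglyGorensteinFlat ?_
  rintro ⟨_ | _⟩
  exacts [hA, hC]

theorem ShortExact.exists_section {A B P : Type*} [AddCommGroup A] [Module R A] [AddCommGroup B]
    [Module R B] [AddCommGroup P] [Module R P] [Module.Projective R P] {i : A →ₗ[R] B}
    {p : B →ₗ[R] P} (h : ShortExact i p) : ∃ s : P →ₗ[R] B, ∀ x, p (s x) = x := by
  obtain ⟨s, hs⟩ := Module.projective_lifting_property p LinearMap.id h.surj
  exact ⟨s, LinearMap.congr_fun hs⟩

theorem ShortExact.exists_retraction {A B P : Type*} [AddCommGroup A] [Module R A]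
    [AddCommGroup B] [Module R B] [AddCommGroup P] [Module R P] [Module.Projective R P]
    {i : A →ₗ[R] B} {p : B →ₗ[R] P} (h : ShortExact i p) :
    ∃ r : B →ₗ[R] A, ∀ a, r (i a) = a := by
  obtain ⟨s, hs⟩ := h.exists_section
  obtain ⟨r, hr⟩ := exists_lift_of_injective i h.inj (LinearMap.id - s ∘ₗ p) (fun b =>
    (h.exact _).1 (by simp [hs]))
  refine ⟨r, fun a => h.inj ?_⟩
  simp [hr, (h.exact (i a)).2 ⟨a, rfl⟩]

theorem shortExact_ker {A B : Type*} [AddCommGroup A] [Module R A] [AddCommGroup B] [Module R B]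
    (p : A →ₗ[R] B) (hp : Surjective p) : ShortExact (LinearMap.ker p).subtype p :=
  ⟨Subtype.val_injective, fun b => ⟨fun h => ⟨⟨b, h⟩, rfl⟩, by rintro ⟨a, rfl⟩; exact a.2⟩, hp⟩

/-- The kernel of `p ∘ q` is the preimage of `A` under `q`, hence covers `A` with the same kernel
`L`. -/
theorem ShortExact.exists_ker_comp {L Q A X P : Type*} [AddCommGroup L] [Module R L]
    [AddCommGroup Q] [Module R Q] [AddCommGroup A] [Module R A] [AddCommGroup X] [Module R X]
    [AddCommGroup P] [Module R P] {i : A →ₗ[R] X} {p : X →ₗ[R] P} {j : L →ₗ[R] Q}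
    {q : Q →ₗ[R] X} (h : ShortExact i p) (hjq : ShortExact j q) :
    ∃ (j' : L →ₗ[R] LinearMap.ker (p ∘ₗ q)) (f : LinearMap.ker (p ∘ₗ q) →ₗ[R] A),
      ShortExact j' f := by
  obtain ⟨f, hf⟩ := exists_lift_of_injective i h.inj
    (q ∘ₗ (LinearMap.ker (p ∘ₗ q)).subtype) (fun t => (h.exact _).1 t.2)
  have hqj : ∀ l, q (j l) = 0 := fun l => (hjq.exact _).2 ⟨l, rfl⟩
  refine ⟨j.codRestrict _ fun l => by
    rw [LinearMap.mem_ker, LinearMap.comp_apply, hqj, map_zero], f,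
    fun a b hab => hjq.inj (congrArg Subtype.val hab), fun b => ?_, fun a => ?_⟩
  · rw [← map_eq_zero_iff i h.inj, hf]
    exact (hjq.exact b.1).trans (exists_congr fun l =>
      ⟨fun hl => Subtype.ext hl, fun hl => congrArg Subtype.val hl⟩)
  · obtain ⟨b, hb⟩ := hjq.surj (i a)
    have hb0 : b ∈ LinearMap.ker (p ∘ₗ q) := by
      rw [LinearMap.mem_ker, LinearMap.comp_apply, hb]
      exact (h.exact _).2 ⟨a, rfl⟩
    exact ⟨⟨b, hb0⟩, h.inj ((hf _).trans hb)⟩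

/-- Here `A` is a direct summand of `X`, so it inherits `Ext¹` vanishing. Embedding `X` in a
projective `Q` with cokernel `G` makes `Q ⧸ A` an extension of `G` by `P`. For a projective cover
term `Q → X`, the kernel of `Q → P` is a summand of `Q` mapping onto `A`. -/
theorem ShortExact.isStronglyGorensteinFlat_left_of_projective {A X P : ModuleCat.{u} R}
    {i : A →ₗ[R] X} {p : X →ₗ[R] P} (h : ShortExact i p) (hX : IsStronglyGorensteinFlat R X)
    (hP : Module.Projective R P) : IsStronglyGorensteinFlat R A := by
  refine isStronglyGorensteinFlat_of_class (fun A => IsStronglyGorensteinFlat R A ∨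
    ∃ (X P : ModuleCat.{u} R) (i : A →ₗ[R] X) (p : X →ₗ[R] P), IsStronglyGorensteinFlat R X ∧
      Module.Projective R P ∧ ShortExact i p) ?_ ?_ ?_ A (Or.inr ⟨X, P, i, p, hX, hP, h⟩)
  · rintro A (hA | ⟨X, P, i, p, hX, hP, h⟩)
    · obtain ⟨A', hA', hs⟩ := hA.exists_cosyzygy
      exact ⟨A', Or.inl hA', hs⟩
    · obtain ⟨G, hG, Q, j, q, hQ, hjq⟩ := hX.exists_cosyzygy
      have hji : ∀ a, q (j (i a)) = 0 := fun a => (hjq.exact _).2 ⟨_, rfl⟩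
      let C := Q ⧸ LinearMap.range (j ∘ₗ i)
      have hC : ∀ b, (LinearMap.range (j ∘ₗ i)).mkQ b = 0 ↔ ∃ a, j (i a) = b :=
        fun b => Submodule.Quotient.mk_eq_zero _
      obtain ⟨f, hf⟩ := exists_factor_of_surjective p h.surj
        ((LinearMap.range (j ∘ₗ i)).mkQ ∘ₗ j) (fun x hx => by
          obtain ⟨a, rfl⟩ := (h.exact x).1 hx
          exact (hC _).2 ⟨a, rfl⟩)
      obtain ⟨g, hg⟩ := exists_factor_of_surjective (LinearMap.range (j ∘ₗ i)).mkQ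
        (Submodule.mkQ_surjective _) q (fun b hb => by
          obtain ⟨a, rfl⟩ := (hC b).1 hb
          exact hji a)
      have hfg : ShortExact f g := by
        refine ⟨(injective_iff_map_eq_zero f).2 fun y hy => ?_, fun b => ?_, fun y => ?_⟩
        · obtain ⟨x, rfl⟩ := h.surj y
          rw [hf] at hy
          obtain ⟨a, ha⟩ := (hC _).1 hy
          exact (h.exact x).2 ⟨a, hjq.inj ha⟩
        · obtain ⟨b, rfl⟩ := Submodule.mkQ_surjective _ b
          rw [hg, hjq.exact]
          constructor
          · rintro ⟨x, rfl⟩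
            exact ⟨p x, hf x⟩
          · rintro ⟨y, hy⟩
            obtain ⟨x, rfl⟩ := h.surj y
            rw [hf, LinearMap.comp_apply, ← sub_eq_zero, ← map_sub] at hy
            obtain ⟨a, ha⟩ := (hC _).1 hy
            exact ⟨x - i a, by rw [map_sub, ha, sub_sub_cancel]⟩
        · obtain ⟨b, rfl⟩ := hjq.surj y
          exact ⟨_, hg b⟩
      refine ⟨ModuleCat.of R C, Or.inl (ShortExact.isStronglyGorensteinFlat
        (B := ModuleCat.of R C) hfg (isStronglyGorensteinFlat_of_projective P) hG),
        Q, j ∘ₗ i, (LinearMap.range (j ∘ₗ i)).mkQ, hQ, hjq.inj.comp h.inj, hC,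
        Submodule.mkQ_surjective _⟩
  · rintro A (hA | ⟨X, P, i, p, hX, hP, h⟩)
    · obtain ⟨A', hA', hs⟩ := hA.exists_syzygy
      exact ⟨A', Or.inl hA', hs⟩
    · obtain ⟨L, hL, Q, j, q, hQ, hjq⟩ := hX.exists_syzygy
      obtain ⟨r, hr⟩ :=
        (shortExact_ker (p ∘ₗ q) (h.surj.comp hjq.surj)).exists_retraction
      obtain ⟨j', f, hf⟩ := h.exists_ker_comp hjq
      exact ⟨L, Or.inl hL, ModuleCat.of R (LinearMap.ker (p ∘ₗ q)), j', f,
        Module.Projective.of_split _ r (LinearMap.ext hr), hf⟩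
  · rintro A (hA | ⟨X, P, i, p, hX, hP, h⟩) F hF
    · exact hA.extVanish F hF
    · obtain ⟨r, hr⟩ := h.exists_retraction
      exact (hX.extVanish F hF).of_retract i r hr

/-- The pullback of two maps with the same codomain. -/
def pullback {B P C : Type*} [AddCommGroup B] [Module R B] [AddCommGroup P] [Module R P]
    [AddCommGroup C] [Module R C] (p : B →ₗ[R] C) (q : P →ₗ[R] C) : Submodule R (B × P) :=
  LinearMap.eqLocus (p ∘ₗ LinearMap.fst R B P) (q ∘ₗ LinearMap.snd R B P)

theorem ShortExact.pullback_snd {A B P C : Type*} [AddCommGroup A] [Module R A] [AddCommGroup B]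
    [Module R B] [AddCommGroup P] [Module R P] [AddCommGroup C] [Module R C] {i : A →ₗ[R] B}
    {p : B →ₗ[R] C} (h : ShortExact i p) (q : P →ₗ[R] C) : ∃ i' : A →ₗ[R] pullback p q,
      ShortExact i' (LinearMap.snd R B P ∘ₗ (pullback p q).subtype) := by
  have h0 : ∀ a, p (i a) = 0 := fun a => (h.exact _).2 ⟨a, rfl⟩
  refine ⟨(LinearMap.inl R B P ∘ₗ i).codRestrict (pullback p q) (fun a => by simp [pullback, h0]),
    fun a b hab => h.inj (congrArg (fun d : pullback p q => d.1.1) hab), ?_, fun y => ?_⟩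
  · rintro ⟨⟨b, y⟩, hd⟩
    constructor
    · intro hy
      obtain rfl : y = 0 := hy
      obtain ⟨a, rfl⟩ := (h.exact b).1 (Eq.trans hd (map_zero q))
      exact ⟨a, rfl⟩
    · rintro ⟨a, ha⟩
      exact congrArg (fun d : pullback p q => d.1.2) ha.symm
  · obtain ⟨b, hb⟩ := h.surj (q y)
    exact ⟨⟨(b, y), hb⟩, rfl⟩

theorem ShortExact.pullback_fst {A B P C : Type*} [AddCommGroup A] [Module R A] [AddCommGroup B]
    [Module R B] [AddCommGroup P] [Module R P] [AddCommGroup C] [Module R C] {j : A →ₗ[R] P}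
    {q : P →ₗ[R] C} (h : ShortExact j q) (p : B →ₗ[R] C) : ∃ j' : A →ₗ[R] pullback p q,
      ShortExact j' (LinearMap.fst R B P ∘ₗ (pullback p q).subtype) := by
  have h0 : ∀ a, q (j a) = 0 := fun a => (h.exact _).2 ⟨a, rfl⟩
  refine ⟨(LinearMap.inr R B P ∘ₗ j).codRestrict (pullback p q) (fun a => by simp [pullback, h0]),
    fun a b hab => h.inj (congrArg (fun d : pullback p q => d.1.2) hab), ?_, fun y => ?_⟩
  · rintro ⟨⟨y, b⟩, hd⟩
    constructor
    · intro hy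
      obtain rfl : y = 0 := hy
      obtain ⟨a, rfl⟩ := (h.exact b).1 (Eq.trans hd.symm (map_zero p))
      exact ⟨a, rfl⟩
    · rintro ⟨a, ha⟩
      exact congrArg (fun d : pullback p q => d.1.1) ha.symm
  · obtain ⟨b, hb⟩ := h.surj (p y)
    exact ⟨⟨(y, b), hb.symm⟩, rfl⟩

/-- Strongly Gorenstein flat modules are closed under kernels of epimorphisms. -/
theorem ShortExact.isStronglyGorensteinFlat_left {A B C : ModuleCat.{u} R} {i : A →ₗ[R] B}
    {p : B →ₗ[R] C} (h : ShortExact i p) (hB : IsStronglyGorensteinFlat R B)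
    (hC : IsStronglyGorensteinFlat R C) : IsStronglyGorensteinFlat R A := by
  obtain ⟨L, hL, Q, j, q, hQ, hjq⟩ := hC.exists_syzygy
  obtain ⟨i', hi'⟩ := h.pullback_snd q
  obtain ⟨j', hj'⟩ := hjq.pullback_fst p
  -- The pullback of `B` and `Q` over `C` is an extension of `B` by `L`, and also of the projective
  -- `Q` by `A`.
  exact ShortExact.isStronglyGorensteinFlat_left_of_projective (X := ModuleCat.of R (pullback p q))
    hi' (ShortExact.isStronglyGorensteinFlat (B := ModuleCat.of R (pullback p q)) hj' hL hB) hQ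

end Closure

/-! ### Resolutions, dimension and cyclic filtrations -/

section Resolution

variable {R : Type u} [Ring R]

/-- Existence of a resolution of length at most `n` by strongly Gorenstein flat modules, by
recursion on `n`. -/
def HasSGFRes : ℕ → ModuleCat.{u} R → Prop
  | 0, M => IsStronglyGorensteinFlat R M
  | n + 1, M => ∃ (N G : ModuleCat.{u} R) (i : N →ₗ[R] G) (p : G →ₗ[R] M),
      IsStronglyGorensteinFlat R G ∧ ShortExact i p ∧ HasSGFRes n N

theorem HasSGFRes.succ {n : ℕ} {M : ModuleCat.{u} R} (h : HasSGFRes n M) :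
    HasSGFRes (n + 1) M := by
  induction n generalizing M with
  | zero =>
    exact ⟨ModuleCat.of R PUnit, M, 0, LinearMap.id, h, ⟨fun _ _ _ => rfl,
      fun b => ⟨fun h => ⟨0, h.symm⟩, fun ⟨_, h⟩ => h.symm⟩, surjective_id⟩,
      isStronglyGorensteinFlat_of_projective PUnit⟩
  | succ n ih =>
    obtain ⟨N, G, i, p, hG, hs, hN⟩ := h
    exact ⟨N, G, i, p, hG, hs, ih hN⟩

theorem HasSGFRes.mono {n m : ℕ} (hnm : n ≤ m) {M : ModuleCat.{u} R} (h : HasSGFRes n M) :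
    HasSGFRes m M := by
  induction hnm with
  | refl => exact h
  | step _ ih => exact ih.succ

/-- The sequence splits, so adding `P` to the first term of a resolution of `N` resolves `X`. -/
theorem HasSGFRes.middle {n : ℕ} {N X P : ModuleCat.{u} R} {i : N →ₗ[R] X} {p : X →ₗ[R] P}
    (h : ShortExact i p) (hP : Module.Projective R P) (hN : HasSGFRes n N) : HasSGFRes n X := by
  cases n with
  | zero => exact h.isStronglyGorensteinFlat hN (isStronglyGorensteinFlat_of_projective P)
  | succ n =>
    obtain ⟨N₁, G, j, q, hG, hjq, hN₁⟩ := hN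
    obtain ⟨s, hs⟩ := h.exists_section
    have hpi : ∀ a, p (i a) = 0 := fun a => (h.exact _).2 ⟨a, rfl⟩
    have hprod : ShortExact (LinearMap.inl R G P) (LinearMap.snd R G P) :=
      ⟨LinearMap.inl_injective, fun b => ⟨fun hb => ⟨b.1, Prod.ext rfl hb.symm⟩,
        by rintro ⟨a, rfl⟩; rfl⟩, LinearMap.snd_surjective⟩
    refine ⟨N₁, ModuleCat.of R (G × P), LinearMap.inl R G P ∘ₗ j, (i ∘ₗ q).coprod s,
      ShortExact.isStronglyGorensteinFlat (B := ModuleCat.of R (G × P)) hprod hG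
        (isStronglyGorensteinFlat_of_projective P),
      ⟨LinearMap.inl_injective.comp hjq.inj, ?_, fun x => ?_⟩, hN₁⟩
    · rintro ⟨g, y⟩
      constructor
      · intro h0
        replace h0 : i (q g) + s y = 0 := h0
        have hy : y = 0 := by
          have := congrArg p h0
          rwa [map_add, hpi, hs, zero_add, map_zero] at this
        subst hy
        rw [map_zero, add_zero, map_eq_zero_iff i h.inj, hjq.exact] at h0
        obtain ⟨a, rfl⟩ := h0
        exact ⟨a, rfl⟩
      · rintro ⟨a, ha⟩
        obtain ⟨rfl, rfl⟩ := Prod.ext_iff.1 ha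
        have : q (j a) = 0 := (hjq.exact _).2 ⟨a, rfl⟩
        simp [this]
    · obtain ⟨a, ha⟩ := (h.exact (x - s (p x))).1 (by rw [map_sub, hs, sub_self])
      obtain ⟨g, rfl⟩ := hjq.surj a
      exact ⟨(g, p x), by simp [ha]⟩

/-- In a resolution of `X` only the first term changes: `G₁` is replaced by the kernel of `G₁ → G`.
-/
theorem HasSGFRes.left {n : ℕ} {K X G : ModuleCat.{u} R} {i : K →ₗ[R] X} {p : X →ₗ[R] G}
    (h : ShortExact i p) (hX : HasSGFRes n X) (hG : IsStronglyGorensteinFlat R G) :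
    HasSGFRes n K := by
  cases n with
  | zero => exact h.isStronglyGorensteinFlat_left hX hG
  | succ n =>
    obtain ⟨N, G₁, j, q, hG₁, hjq, hN⟩ := hX
    obtain ⟨j', f, hf⟩ := h.exists_ker_comp hjq
    exact ⟨N, ModuleCat.of R (LinearMap.ker (p ∘ₗ q)), j', f,
      ShortExact.isStronglyGorensteinFlat_left (A := ModuleCat.of R (LinearMap.ker (p ∘ₗ q)))
        (shortExact_ker (p ∘ₗ q) (h.surj.comp hjq.surj)) hG₁ hG, hf, hN⟩

/-- A Schanuel argument: the pullback of `G` and `P` over `M` is an extension of `P` by `N`, so it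
has a resolution of length `n`, and `K` is the kernel of its map onto `G`. -/
theorem HasSGFRes.syzygy {n : ℕ} {K M : ModuleCat.{u} R} (h : IsSyzygy K M)
    (hM : HasSGFRes (n + 1) M) : HasSGFRes n K := by
  obtain ⟨P, j, q, hP, hjq⟩ := h
  obtain ⟨N, G, i, p, hG, hip, hN⟩ := hM
  obtain ⟨i', hi'⟩ := hip.pullback_snd q
  obtain ⟨j', hj'⟩ := hjq.pullback_fst p
  exact HasSGFRes.left (X := ModuleCat.of R (pullback p q)) hj' (HasSGFRes.middle hi' hP hN) hG

theorem exists_isSyzygy (M : ModuleCat.{u} R) : ∃ K : ModuleCat.{u} R, IsSyzygy K M := by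
  have hs : Surjective (Finsupp.linearCombination R (id : M → M)) :=
    Finsupp.linearCombination_id_surjective R M
  exact ⟨ModuleCat.of R _, ModuleCat.of R (M →₀ R), _, _,
    inferInstanceAs (Module.Projective R (M →₀ R)), shortExact_ker _ hs⟩

/-- Syzygies of the quotients `A x` filter a syzygy of `K`, and both sides drop by one in length. -/
theorem Filtration.hasSGFRes {ι : Type u} [LinearOrder ι] [WellFoundedLT ι] {n : ℕ}
    {K : ModuleCat.{u} R} {A : ι → ModuleCat.{u} R} (Φ : Filtration (⊥ : Submodule R K) A)
    (h : ∀ x, HasSGFRes n (A x)) : HasSGFRes n K := by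
  induction n generalizing K A with
  | zero => exact Φ.isStronglyGorensteinFlat h
  | succ n ih =>
    choose A' hA' using fun x => exists_isSyzygy (A x)
    obtain ⟨K', ⟨Q, j, q, hQ, hjq⟩, ⟨Φ'⟩⟩ := Φ.exists_syzygy hA'
    exact ⟨K', Q, j, q, isStronglyGorensteinFlat_of_projective Q, hjq,
      ih Φ' fun x => (h x).syzygy (hA' x)⟩

theorem HasSGFRes.of_hasSGFResolution {n : ℕ} {M : ModuleCat.{u} R}
    (h : HasSGFResolution R M n) : HasSGFRes n M := by
  obtain ⟨G, d, ε, hε, h0, hd, hG, hz⟩ := h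
  induction n generalizing G M with
  | zero =>
    have := hz 1 one_pos
    refine (hG 0 le_rfl).of_equiv (LinearEquiv.ofBijective ε
      ⟨(injective_iff_map_eq_zero ε).2 fun x hx => ?_, hε⟩)
    obtain ⟨y, rfl⟩ := (h0 x).1 hx
    exact (congrArg (d 0) (Subsingleton.elim (α := G 1) y 0)).trans (map_zero _)
  | succ n ih =>
    have hs := shortExact_ker ε hε
    refine ⟨ModuleCat.of R (LinearMap.ker ε), G 0, _, ε, hG 0 (Nat.zero_le _), hs,
      ih (fun i => G (i + 1)) (fun i => d (i + 1))
        ((d 0).codRestrict (LinearMap.ker ε) fun x => (h0 _).2 ⟨x, rfl⟩) ?_ ?_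
        (fun i => hd (i + 1)) (fun i hi => hG _ (Nat.succ_le_succ hi))
        (fun i hi => hz _ (Nat.succ_lt_succ hi))⟩
    · intro y
      obtain ⟨x, hx⟩ := (h0 _).1 y.2
      exact ⟨x, Subtype.ext hx⟩
    · intro x
      exact Subtype.ext_iff.trans (hd 0 x)

theorem HasSGFRes.hasSGFResolution {n : ℕ} {M : ModuleCat.{u} R} (h : HasSGFRes n M) :
    HasSGFResolution R M n := by
  induction n generalizing M with
  | zero =>
    let G : ℕ → ModuleCat.{u} R
      | 0 => M
      | _ + 1 => ModuleCat.of R PUnit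
    refine ⟨G, fun i => 0, LinearMap.id, surjective_id,
      fun x => ⟨fun hx => ⟨0, hx.symm⟩, fun ⟨_, hx⟩ => hx.symm⟩,
      fun i x => iff_of_true rfl ⟨0, rfl⟩, fun i hi => ?_, fun i hi => ?_⟩
    · obtain rfl : i = 0 := Nat.le_zero.1 hi
      exact h
    · obtain ⟨k, rfl⟩ := Nat.exists_eq_succ_of_ne_zero hi.ne'
      exact inferInstanceAs (Subsingleton PUnit)
  | succ n ih =>
    obtain ⟨N, G₀, i, p, hG₀, hs, hN⟩ := h
    obtain ⟨G, d, ε, hε, h0, hd, hG, hz⟩ := ih hN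
    let G' : ℕ → ModuleCat.{u} R
      | 0 => G₀
      | k + 1 => G k
    let d' : ∀ k, G' (k + 1) →ₗ[R] G' k
      | 0 => i ∘ₗ ε
      | k + 1 => d k
    refine ⟨G', d', p, hs.surj, fun x => ?_, fun k => ?_, fun k hk => ?_, fun k hk => ?_⟩
    · exact (hs.exact x).trans hε.exists
    · match k with
      | 0 => exact fun x => (map_eq_zero_iff i hs.inj).trans (h0 x)
      | k + 1 => exact hd k
    · match k with
      | 0 => exact hG₀
      | k + 1 => exact hG k (Nat.le_of_succ_le_succ hk)
    · match k with
      | k + 1 => exact hz k (Nat.lt_of_succ_lt_succ hk)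

theorem sgfd_le_iff {n : ℕ} {M : ModuleCat.{u} R} : sgfd R M ≤ n ↔ HasSGFRes n M := by
  constructor
  · intro h
    -- A strict bound by `n + 1` extracts an actual resolution from the infimum.
    have hlt : sgfd R M < ((n + 1 : ℕ) : ℕ∞) := h.trans_lt (by exact_mod_cast n.lt_succ_self)
    simp only [sgfd, iInf_lt_iff] at hlt
    obtain ⟨m, hm, hmn⟩ := hlt
    exact (HasSGFRes.of_hasSGFResolution hm).mono (Nat.lt_succ_iff.1 (by exact_mod_cast hmn))
  · intro h
    exact iInf₂_le n h.hasSGFResolution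

/-- Every module has a filtration with cyclic successive quotients. -/
theorem exists_cyclic_filtration (M : ModuleCat.{u} R) : ∃ (ι : Type u) (_ : LinearOrder ι)
    (_ : WellFoundedLT ι) (I : ι → Ideal R),
    Nonempty (Filtration (⊥ : Submodule R M) fun x => ModuleCat.of R (R ⧸ I x)) := by
  obtain ⟨hlin, hwf⟩ := exists_wellFoundedLT (α := M)
  -- The part at `x` is `S x + R x`, whose quotient by `S x` is `R` modulo the left ideal of all `r`
  -- with `r • x ∈ S x`.
  let S : M → Submodule R M := fun x => Submodule.span R (Set.Iio x)
  let i : ∀ x, S x × R →ₗ[R] M := fun x => (S x).subtype.coprod (LinearMap.toSpanSingleton R M x)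
  have hi : ∀ x y, x ≤ y → LinearMap.range (i x) ≤ LinearMap.range (i y) := by
    intro x y hxy
    rcases eq_or_lt_of_le hxy with rfl | hlt
    · exact le_rfl
    · rintro _ ⟨⟨s, r⟩, rfl⟩
      refine ⟨(⟨s + r • x, Submodule.add_mem _ (Submodule.span_mono (Set.Iio_subset_Iio hxy) s.2)
        (Submodule.smul_mem _ _ (Submodule.subset_span hlt))⟩, 0), by simp [i]⟩
  have hself : ∀ x, x ∈ LinearMap.range (i x) := fun x => ⟨(0, 1), by simp [i]⟩
  have hS : ∀ x k, k ∈ S x ↔ k ∈ (⊥ : Submodule R M) ∨ ∃ y < x, k ∈ LinearMap.range (i y) := by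
    intro x k
    constructor
    · intro hk
      induction hk using Submodule.span_induction with
      | mem y hy => exact Or.inr ⟨y, hy, hself y⟩
      | zero => exact Or.inl (Submodule.zero_mem _)
      | add a b _ _ ha hb =>
        rcases ha with ha | ⟨y, hy, ha⟩
        · rw [(Submodule.mem_bot R).1 ha, zero_add]
          exact hb
        rcases hb with hb | ⟨z, hz, hb⟩
        · rw [(Submodule.mem_bot R).1 hb, add_zero]
          exact Or.inr ⟨y, hy, ha⟩
        exact Or.inr ⟨max y z, max_lt hy hz, Submodule.add_mem _ (hi _ _ (le_max_left _ _) ha)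
          (hi _ _ (le_max_right _ _) hb)⟩
      | smul r a _ ha =>
        exact ha.imp (Submodule.smul_mem _ r) fun ⟨y, hy, ha⟩ =>
          ⟨y, hy, Submodule.smul_mem _ r ha⟩
    · rintro (h0 | ⟨y, hy, ⟨s, r⟩, rfl⟩)
      · rw [(Submodule.mem_bot R).1 h0]
        exact Submodule.zero_mem _
      · exact Submodule.add_mem _ (Submodule.span_mono (Set.Iio_subset_Iio hy.le) s.2)
          (Submodule.smul_mem _ _ (Submodule.subset_span hy))
  refine ⟨M, hlin, hwf, fun x => (S x).comap (LinearMap.toSpanSingleton R M x),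
    Filtration.exists_of_maps (T := fun x => S x × R) i
      (fun x => Submodule.mkQ _ ∘ₗ LinearMap.snd R (S x) R) hi (fun _ => bot_le)
      (fun k => Or.inr ⟨k, hself k⟩)
      (fun x => (Submodule.mkQ_surjective _).comp LinearMap.snd_surjective) ?_⟩
  rintro x ⟨s, r⟩
  rw [← hS]
  refine (Submodule.Quotient.mk_eq_zero _).trans ?_
  exact ((S x).add_mem_iff_right s.2).symm

theorem leftGlobalSGFDim_le_iSup_quotient :
    leftGlobalSGFDim R ≤ ⨆ I : Ideal R, sgfd R (R ⧸ I) := by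
  refine iSup_le fun M => ?_
  -- An infinite supremum bounds everything; a finite one bounds all cyclic quotients of a
  -- filtration uniformly.
  generalize hS : (⨆ I : Ideal R, sgfd R (R ⧸ I)) = S
  induction S using ENat.recTopCoe with
  | top => exact le_top
  | coe n =>
    obtain ⟨ι, _, _, I, ⟨Φ⟩⟩ := exists_cyclic_filtration M
    refine sgfd_le_iff.2 (Φ.hasSGFRes fun x => sgfd_le_iff.1 ?_)
    rw [← hS]
    exact le_iSup (fun I : Ideal R => sgfd R (R ⧸ I)) (I x)

end Resolution

end SGFlat

theorem mainTheorem6 (R : Type u) [Ring R] :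
    (SGFlat.leftGlobalSGFDim R =
        ⨆ (M : ModuleCat.{u} R) (_ : Module.Finite R M), SGFlat.sgfd R M) ∧
      (SGFlat.leftGlobalSGFDim R = ⨆ I : Ideal R, SGFlat.sgfd R (R ⧸ I)) := by
  have h1 : (⨆ I : Ideal R, SGFlat.sgfd R (R ⧸ I)) ≤
      ⨆ (M : ModuleCat.{u} R) (_ : Module.Finite R M), SGFlat.sgfd R M :=
    iSup_le fun I => le_iSup₂_of_le (ModuleCat.of R (R ⧸ I))
      (inferInstanceAs (Module.Finite R (R ⧸ I))) le_rfl
  have h2 : (⨆ (M : ModuleCat.{u} R) (_ : Module.Finite R M), SGFlat.sgfd R M) ≤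
      SGFlat.leftGlobalSGFDim R :=
    iSup₂_le fun M _ => le_iSup (fun M : ModuleCat.{u} R => SGFlat.sgfd R M) M
  have h3 := SGFlat.leftGlobalSGFDim_le_iSup_quotient (R := R)
  exact ⟨le_antisymm (h3.trans h1) h2, le_antisymm h3 (h1.trans h2)⟩
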